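/- Let $k\le n$ be positive integers. A Fubini word $w=w_1\cdots w_n\in\mathcal W_{n,k}$ is a surjective map $w:[n]\to[k]$, $w(i)=w_i$. Let $\alpha_a=\alpha_a(w)$ be the position of the first letter $a$ in $w$, and let $\mathrm{in}(w)=\{\alpha_1,\dots,\alpha_k\}$ be the set of initial positions. Let $P_w$ be the set of complex $k\times n$ matrices $Y$ such that $Y_{w_j,j}=1$ for all $j\in[n]$, the entries $Y_{w_i,j}$ with $i\in\mathrm{in}(w)$, $i<\alpha_{w_j}$, and either ($j\in\mathrm{in}(w)$ and $w_i<w_j$) or $j\notin\mathrm{in}(w)$, are arbitrary, and all other entries are $0$. Let $U\subset GL_k(\mathbb C)$ be the group of lower unitriangular matrices, and let $C_w=UP_w=\{XY : X\in U,\ Y\in P_w\}$. Let $X_{n,k}=\{(l_1,\dots,l_n)\in(\mathbb P^{k-1})^n : l_1+\cdots+l_n=\mathbb C^k\}$ be the space of spanning line configurations, where $\mathbb P^{k-1}$ is the set of lines through $0$ in $\mathbb C^k$, with the subspace topology of the Zariski topology on $(\mathbb P^{k-1})^n$ (whose closed sets are the common zero sets of families of multihomogeneous polynomials). A complex $k\times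 n$ matrix of rank $k$ without zero columns represents the configuration of the lines spanned by its columns. The PR variety $\overline C_w$ is the closure in $X_{n,k}$ of the set of configurations represented by the matrices in $C_w$. For $J\subseteq[n]$ with $1\le|J|\le k$, the flag minor $\Delta_J(A)$ of a $k\times n$ matrix $A$ is the minor with rows $1,\dots,|J|$ and columns $J$. Let $T_w$ be the set of those $J$ for which $\Delta_J(M)=0$ for all $M\in C_w$. Theorem. For every Fubini word $w\in\mathcal W_{n,k}$, $$\overline C_w=\{A\in X_{n,k} : \Delta_J(A)=0 \text{ for all } J\in T_w\},$$ that is, $\overline C_w$ is the set of spanning line configurations represented by some $k\times n$ matrix $A$ of rank $k$ without zero columns with $\Delta_J(A)=0$ for all $J\in T_w$; moreover, if a configuration is in $\overline C_w$, then every matrix representing it has this property. -/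

import Mathlib

noncomputable section

namespace FubiniFlag

/-- Fubini words of length `n` on the alphabet `[k]`: surjective maps `[n] → [k]`
(positions and letters are indexed from `0`). -/
def FubiniWord (n k : ℕ) : Type := {w : Fin n → Fin k // Function.Surjective w}

variable {n k : ℕ}

instance : CoeFun (FubiniWord n k) (fun _ => Fin n → Fin k) := ⟨fun w => w.1⟩

lemma FubiniWord.fiber_nonempty (w : FubiniWord n k) (a : Fin k) :
    (Finset.univ.filter (fun j : Fin n => w j = a)).Nonempty := by
  obtain ⟨j, hj⟩ := w.2 a
  exact ⟨j, by simpa using hj⟩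

/-- `α_a(w)`: the position of the first letter `a` in `w`. -/
def alpha (w : FubiniWord n k) (a : Fin k) : Fin n :=
  (Finset.univ.filter (fun j : Fin n => w j = a)).min' (w.fiber_nonempty a)

/-- The set `in(w)` of initial positions of `w`. -/
def initialPositions (w : FubiniWord n k) : Set (Fin n) := Set.range (alpha w)

/-- The entry in row `r` and column `j` of the pattern matrix of `w` is a `⋆`. -/
def IsStar (w : FubiniWord n k) (r : Fin k) (j : Fin n) : Prop :=
  ∃ i : Fin n, w i = r ∧ i ∈ initialPositions w ∧ i < alpha w (w j) ∧
    ((j ∈ initialPositions w ∧ w i < w j) ∨ j ∉ initialPositions w)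

/-- `P_w`: the set of matrices fitting the pattern of `w`.  They have a `1` in each position
`(w j, j)`, arbitrary entries in the `⋆` positions, and `0` everywhere else. -/
def patternSet (w : FubiniWord n k) : Set (Matrix (Fin k) (Fin n) ℂ) :=
  {A | ∀ (r : Fin k) (j : Fin n),
    (r = w j → A r j = 1) ∧ (r ≠ w j → ¬ IsStar w r j → A r j = 0)}

/-- `U`: the lower unitriangular `k × k` matrices. -/
def lowerUnitriangular (k : ℕ) : Set (Matrix (Fin k) (Fin k) ℂ) :=
  {X | (∀ i, X i i = 1) ∧ ∀ i j, i < j → X i j = 0}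

/-- The PR cell `C_w = U P_w`, as a set of matrices. -/
def cellMatrices (w : FubiniWord n k) : Set (Matrix (Fin k) (Fin n) ℂ) :=
  {A | ∃ X ∈ lowerUnitriangular k, ∃ Y ∈ patternSet w, A = X * Y}

/-- The nonempty subsets `J` of `[n]` with at most `k` elements. -/
def FlagIndex (n k : ℕ) : Type := {J : Finset (Fin n) // 1 ≤ J.card ∧ J.card ≤ k}

/-- The flag minor `Δ_J(A)`: rows `1, …, |J|` and columns `J` (in increasing order). -/
def flagMinor (J : FlagIndex n k) (A : Matrix (Fin k) (Fin n) ℂ) : ℂ :=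
  (A.submatrix (Fin.castLE J.2.2) (J.1.orderEmbOfFin rfl)).det

/-- `T_w`: the indices of the flag minors that vanish on all matrices in the cell of `w`. -/
def trulyVanishing (w : FubiniWord n k) : Set (FlagIndex n k) :=
  {J | ∀ M ∈ cellMatrices w, flagMinor J M = 0}

/-- The `k × n` complex matrices of full rank `k` without zero columns. -/
def FullRankMatrix (n k : ℕ) : Type :=
  {A : Matrix (Fin k) (Fin n) ℂ // A.rank = k ∧ ∀ j, A.col j ≠ 0}

/-- The product of projective spaces `(ℙ^{k-1})^n`. -/
abbrev LineTuple (n k : ℕ) : Type := Fin n → Projectivization ℂ (Fin k → ℂ)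

/-- `X_{n,k}`: the tuples of lines in `ℂ^k` whose vector space sum is `ℂ^k`. -/
def SpanningLineConfig (n k : ℕ) : Type :=
  {l : LineTuple n k // ⨆ j, (l j).submodule = ⊤}

/-- The polynomial `f` in the entries `x_{rj}` of a `k × n` matrix is multihomogeneous: for each
column `j`, it is homogeneous in the variables `x_{1j}, …, x_{kj}`. -/
def IsMultihomogeneous (f : MvPolynomial (Fin k × Fin n) ℂ) : Prop :=
  ∃ d : Fin n → ℕ,
    MvPolynomial.IsWeightedHomogeneous (fun p : Fin k × Fin n => (Pi.single p.2 1 : Fin n → ℕ)) f d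

/-- The value of `f` at the matrix whose columns are chosen representatives of the lines `l j`.
For multihomogeneous `f`, whether it is zero does not depend on the choice. -/
def evalRep (f : MvPolynomial (Fin k × Fin n) ℂ) (l : LineTuple n k) : ℂ :=
  MvPolynomial.eval (fun p : Fin k × Fin n => (l p.2).rep p.1) f

/-- The common zeros in `(ℙ^{k-1})^n` of a set of polynomials. -/
def zeroLocus (S : Set (MvPolynomial (Fin k × Fin n) ℂ)) : Set (LineTuple n k) :=
  {l | ∀ f ∈ S, evalRep f l = 0}

/-- The Zariski closed subsets of `(ℙ^{k-1})^n`. -/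
def IsZariskiClosed (Z : Set (LineTuple n k)) : Prop :=
  ∃ S : Set (MvPolynomial (Fin k × Fin n) ℂ), (∀ f ∈ S, IsMultihomogeneous f) ∧ Z = zeroLocus S

lemma IsMultihomogeneous.mul {f g : MvPolynomial (Fin k × Fin n) ℂ}
    (hf : IsMultihomogeneous f) (hg : IsMultihomogeneous g) : IsMultihomogeneous (f * g) := by
  obtain ⟨d, hd⟩ := hf
  obtain ⟨e, he⟩ := hg
  exact ⟨d + e, MvPolynomial.IsWeightedHomogeneous.mul hd he⟩

/-- The Zariski topology on `(ℙ^{k-1})^n`. -/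
@[reducible]
def zariskiTopology (n k : ℕ) : TopologicalSpace (LineTuple n k) :=
  TopologicalSpace.ofClosed {Z | IsZariskiClosed Z}
    ⟨{1}, by
      simpa using ⟨0, MvPolynomial.isWeightedHomogeneous_one ℂ _⟩, by
      ext l
      simp [zeroLocus, evalRep]⟩
    (by
      intro 𝒜 h𝒜
      refine ⟨{f | IsMultihomogeneous f ∧ ∃ Z ∈ 𝒜, ∀ l ∈ Z, evalRep f l = 0},
        fun f hf => hf.1, ?_⟩
      ext l
      constructor
      · rintro hl f ⟨-, Z, hZ, hf⟩
        exact hf l (hl Z hZ)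
      · intro hl Z hZ
        obtain ⟨S, hS, rfl⟩ := h𝒜 hZ
        exact fun f hf => hl f ⟨hS f hf, _, hZ, fun m hm => hm f hf⟩)
    (by
      rintro _ ⟨S, hS, rfl⟩ _ ⟨S', hS', rfl⟩
      refine ⟨{h | ∃ f ∈ S, ∃ g ∈ S', h = f * g}, ?_, ?_⟩
      · rintro _ ⟨f, hf, g, hg, rfl⟩
        exact (hS f hf).mul (hS' g hg)
      · ext l
        constructor
        · rintro (hl | hl) _ ⟨f, hf, g, hg, rfl⟩
          · simp [evalRep, show MvPolynomial.eval _ f = 0 from hl f hf]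
          · simp [evalRep, show MvPolynomial.eval _ g = 0 from hl g hg]
        · intro hl
          by_contra hcon
          simp only [Set.mem_union, not_or, zeroLocus, Set.mem_ofPred_eq, not_forall] at hcon
          obtain ⟨⟨f, hf, hf0⟩, g, hg, hg0⟩ := hcon
          have := hl _ ⟨f, hf, g, hg, rfl⟩
          simp only [evalRep, map_mul, mul_eq_zero] at this
          exact this.elim hf0 hg0)

/-- The Zariski topology on `X_{n,k}`, as a subspace of `(ℙ^{k-1})^n`. -/
instance : TopologicalSpace (SpanningLineConfig n k) :=
  TopologicalSpace.induced Subtype.val (zariskiTopology n k)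

/-- The spanning line configuration represented by a matrix: the tuple of the lines spanned by
its columns. -/
def toConfig (A : FullRankMatrix n k) : SpanningLineConfig n k :=
  ⟨fun j => Projectivization.mk ℂ (A.1.col j) (A.2.2 j), by
    have h := A.2.1
    rw [Matrix.rank_eq_finrank_span_cols] at h
    have h2 : Submodule.span ℂ (Set.range A.1.col) = ⊤ :=
      Submodule.eq_top_of_finrank_eq (by simpa using h)
    rw [← h2, Submodule.span_range_eq_iSup]
    simp [Projectivization.submodule_mk]⟩

/-- The PR cell `C_w` in `X_{n,k}`: the configurations represented by matrices in `U P_w`. -/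
def prCell (w : FubiniWord n k) : Set (SpanningLineConfig n k) :=
  toConfig '' {A | A.1 ∈ cellMatrices w}

/-- The PR variety: the Zariski closure of the PR cell in `X_{n,k}`. -/
def prVariety (w : FubiniWord n k) : Set (SpanningLineConfig n k) :=
  closure (prCell w)

end FubiniFlag

end

noncomputable section

namespace FubiniFlag

variable {n k : ℕ}

/-! ### Lower unitriangular matrices -/

/-! Flag minors are multihomogeneous, so those vanishing on the cell vanish on its Zariski closure.
For the converse, let `σ` list the letters of `w` by first appearance and put `μ j = σ⁻¹ (w j)`. Row
operations show that each matrix in `openPermCell μ σ` is a column rescaling of one in `C_w`. Hence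
a multihomogeneous polynomial vanishing on `C_w` vanishes on `openPermCell μ σ` and, by continuity,
on its Euclidean closure. It remains to put `A` into that closure.

If `J` has `r + 1` elements, more than `headCount σ m r` of them with `μ j < m`, then `Δ_J` vanishes
on the cell for lack of rows. At a matrix `A` of rank `k`, vanishing of these minors bounds the rank
of the first `r + 1` rows on the columns `μ j < m` by `headCount σ m r`. So at least `tailCount σ m
r` of these rows depend on the rows above them. A greedy choice of such a row `τ m` for each `m`
gives a permutation with `A ∈ permCell μ τ` and tail counts at least those of `σ`, that is, `τ ≥ σ`
in Bruhat order. A chain of transpositions descends from `τ` to `σ`, and each one puts a cell into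
the closure of the next. -/

lemma mul_mem_lowerUnitriangular {X Y : Matrix (Fin k) (Fin k) ℂ}
    (hX : X ∈ lowerUnitriangular k) (hY : Y ∈ lowerUnitriangular k) :
    X * Y ∈ lowerUnitriangular k := by
  refine ⟨fun i => ?_, fun i j hij => ?_⟩
  · rw [Matrix.mul_apply, Finset.sum_eq_single i]
    · simp [hX.1, hY.1]
    · intro l _ hl
      rcases lt_or_gt_of_ne hl with h | h
      · simp [hY.2 l i h]
      · simp [hX.2 i l h]
    · simp
  · rw [Matrix.mul_apply]
    refine Finset.sum_eq_zero fun l _ => ?_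
    rcases le_or_gt l i with h | h
    · simp [hY.2 l j (h.trans_lt hij)]
    · simp [hX.2 i l h]

lemma det_of_mem_lowerUnitriangular {X : Matrix (Fin k) (Fin k) ℂ}
    (hX : X ∈ lowerUnitriangular k) : X.det = 1 := by
  rw [Matrix.det_of_isLowerTriangular X fun i j hij => hX.2 i j hij]
  simp [hX.1]

lemma exists_left_inverse_mem_lowerUnitriangular {X : Matrix (Fin k) (Fin k) ℂ}
    (hX : X ∈ lowerUnitriangular k) : ∃ Y ∈ lowerUnitriangular k, Y * X = 1 := by
  have hdet : IsUnit X.det := by simp [det_of_mem_lowerUnitriangular hX]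
  have hinv : X⁻¹ * X = 1 := Matrix.nonsing_inv_mul X hdet
  have htri : ∀ i j, i < j → X⁻¹ i j = 0 := by
    have : Invertible X := Matrix.invertibleOfIsUnitDet X hdet
    have h : X.BlockTriangular OrderDual.toDual := fun i j hij => hX.2 i j hij
    exact fun i j hij => Matrix.blockTriangular_inv_of_blockTriangular h hij
  refine ⟨X⁻¹, ⟨fun i => ?_, htri⟩, hinv⟩
  have h := congrFun (congrFun hinv i) i
  rw [Matrix.mul_apply, Finset.sum_eq_single i] at h
  · simpa [hX.1] using h
  · intro l _ hl
    rcases lt_or_gt_of_ne hl with h | h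
    · simp [hX.2 l i h]
    · simp [htri i l h]
  · simp

/-! ### Cells attached to a permutation -/

/-- The matrices whose column `j` is supported on the rows up to `μ j`. -/
def shapedMatrices (μ : Fin n → Fin k) : Set (Matrix (Fin k) (Fin n) ℂ) :=
  {Q | ∀ p j, μ j < p → Q p j = 0}

/-- The matrices `b τ Q` with `b` lower unitriangular, `τ` a permutation matrix, and the column `j`
of `Q` supported on the rows up to `μ j`. -/
def permCell (μ : Fin n → Fin k) (τ : Equiv.Perm (Fin k)) : Set (Matrix (Fin k) (Fin n) ℂ) :=
  {A | ∃ b ∈ lowerUnitriangular k, ∃ Q ∈ shapedMatrices μ, A = b * Q.submatrix τ.symm id}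

/-- The part of `permCell μ τ` where `Q` has nonzero entries in the positions `(μ j, j)`. -/
def openPermCell (μ : Fin n → Fin k) (τ : Equiv.Perm (Fin k)) :
    Set (Matrix (Fin k) (Fin n) ℂ) :=
  {A | ∃ b ∈ lowerUnitriangular k, ∃ Q ∈ shapedMatrices μ, (∀ j, Q (μ j) j ≠ 0) ∧
    A = b * Q.submatrix τ.symm id}

/-- Cofinite subsets of `ℂ` are dense, so finitely many bad parameters on a line do not matter in
the limit `t = 0`. Closures of sets of matrices are Euclidean throughout. -/
lemma mem_closure_of_line {S : Set (Matrix (Fin k) (Fin n) ℂ)} {F : Set ℂ} (hF : F.Finite)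
    (b : Matrix (Fin k) (Fin k) ℂ) (τ : Equiv.Perm (Fin k)) (Q R : Matrix (Fin k) (Fin n) ℂ)
    (h : ∀ t ∉ F, b * (Q + t • R).submatrix τ.symm id ∈ S) :
    b * Q.submatrix τ.symm id ∈ closure S := by
  have hd : Dense Fᶜ := hF.countable.dense_compl ℂ
  have hc : Continuous fun t : ℂ => b * (Q + t • R).submatrix τ.symm id := by fun_prop
  have h0 : (0 : ℂ) ∈ closure Fᶜ := hd 0
  have := map_mem_closure hc h0 (fun t ht => h t ht)
  simpa using this

lemma permCell_subset_closure_openPermCell (μ : Fin n → Fin k) (τ : Equiv.Perm (Fin k)) :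
    permCell μ τ ⊆ closure (openPermCell μ τ) := by
  rintro _ ⟨b, hb, Q, hQ, rfl⟩
  -- The excluded `t` are those for which some entry `Q (μ j) j + t` vanishes.
  refine mem_closure_of_line (F := Set.range fun j => - Q (μ j) j) (Set.finite_range _) b τ Q
    (Matrix.of fun p j => if p = μ j then 1 else 0) fun t ht => ?_
  refine ⟨b, hb, _, ?_, ?_, rfl⟩
  · intro p j hp
    simp [hQ p j hp, hp.ne']
  · intro j hj
    refine ht ⟨j, ?_⟩
    simp only [Matrix.add_apply, Matrix.smul_apply, Matrix.of_apply, if_true, smul_eq_mul,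
      mul_one] at hj
    linear_combination -hj

/-- Deform row `j` of `Q` to `Q_j + t Q_i`. This may break the shape in row `j` but fits it in row
`i < j`, where the swap moves it. -/
lemma permCell_subset_closure_of_swap (μ : Fin n → Fin k) (τ : Equiv.Perm (Fin k)) {i j : Fin k}
    (hij : i < j) (hτ : τ j < τ i) :
    permCell μ τ ⊆ closure (permCell μ (τ * Equiv.swap i j)) := by
  rintro _ ⟨b, hb, Q, hQ, rfl⟩
  refine mem_closure_of_line (F := {0}) (Set.finite_singleton _) b τ Q
    (Matrix.of fun p l => if p = j then Q i l else 0) fun t ht => ?_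
  have ht : t ≠ 0 := ht
  have hne : τ i ≠ τ j := hτ.ne'
  -- The elementary factor is lower triangular because `τ j < τ i`. It restores row `τ i`: `-t⁻¹ Q_j
  -- + t⁻¹ (Q_j + t Q_i) = Q_i`.
  refine ⟨b * (1 + Matrix.single (τ i) (τ j) t⁻¹), mul_mem_lowerUnitriangular hb ?_,
    Matrix.of fun p l => if p = i then Q j l + t * Q i l else
      if p = j then - t⁻¹ * Q j l else Q p l, ?_, ?_⟩
  · refine ⟨fun a => ?_, fun a c hac => ?_⟩
    · have : ¬ (τ i = a ∧ τ j = a) := fun h => hne (h.1.trans h.2.symm)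
      simp [this]
    · have : ¬ (τ i = a ∧ τ j = c) := by
        rintro ⟨rfl, rfl⟩
        exact absurd hac hτ.not_gt
      simp [hac.ne, this]
  · intro p l hp
    by_cases h1 : p = i
    · subst h1
      simp [hQ p l hp, hQ j l (hp.trans hij)]
    · by_cases h2 : p = j
      · subst h2
        simp [h1, hQ p l hp]
      · simp [h1, h2, hQ p l hp]
  · rw [Matrix.mul_assoc]
    congr 1
    ext r l
    obtain ⟨p, rfl⟩ := τ.surjective r
    rw [Matrix.add_mul, Matrix.one_mul, Matrix.add_apply]
    have hs : (τ * Equiv.swap i j).symm = τ.symm.trans (Equiv.swap i j) := by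
      ext x; simp [Equiv.Perm.mul_def]
    simp only [Matrix.submatrix_apply, hs, Equiv.trans_apply, Equiv.symm_apply_apply, id,
      Matrix.add_apply, Matrix.smul_apply, Matrix.of_apply, smul_eq_mul]
    by_cases h1 : p = i
    · subst h1
      rw [Matrix.single_mul_apply_same]
      simp [hij.ne, hij.ne']
      field_simp
      ring
    · rw [Matrix.single_mul_apply_of_ne _ _ _ _ _ (by simpa using h1)]
      by_cases h2 : p = j
      · subst h2
        simp
      · simp [h1, h2, Equiv.swap_apply_of_ne_of_ne]

/-! ### The Bruhat order by tail counts -/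

/-- The number of positions `p ≥ m` with value `τ p ≤ r`. -/
def tailCount (τ : Fin k → Fin k) (m r : Fin k) : ℕ :=
  (Finset.univ.filter fun p => m ≤ p ∧ τ p ≤ r).card

lemma tailCount_split (τ : Fin k → Fin k) (m : Fin k) {r s : Fin k} (h : r ≤ s) :
    tailCount τ m s = tailCount τ m r +
      (Finset.univ.filter fun p => m ≤ p ∧ r < τ p ∧ τ p ≤ s).card := by
  unfold tailCount
  rw [← Finset.card_union_of_disjoint]
  · congr 1
    ext p
    simp only [Finset.mem_filter, Finset.mem_univ, true_and, Finset.mem_union]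
    constructor
    · rintro ⟨h1, h2⟩
      rcases le_or_gt (τ p) r with h3 | h3
      · exact Or.inl ⟨h1, h3⟩
      · exact Or.inr ⟨h1, h3, h2⟩
    · rintro (⟨h1, h2⟩ | ⟨h1, h2, h3⟩)
      · exact ⟨h1, h2.trans h⟩
      · exact ⟨h1, h3⟩
  · rw [Finset.disjoint_filter]
    rintro p - ⟨_, h1⟩ ⟨_, h2, _⟩
    exact absurd h1 h2.not_ge

/-- The swap moves the smaller value `τ j` back to position `i`. The tail from `m` loses one exactly
when `m` separates the two positions and `r` separates the two values. -/
lemma tailCount_swap_add (τ : Equiv.Perm (Fin k)) {i j : Fin k} (hij : i < j) (hτ : τ j < τ i)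
    (m r : Fin k) :
    tailCount (τ * Equiv.swap i j) m r + (if i < m ∧ m ≤ j ∧ τ j ≤ r ∧ r < τ i then 1 else 0) =
      tailCount τ m r := by
  have key : ∀ f : Fin k → Fin k, tailCount f m r =
      (Finset.univ.filter fun p => (p ≠ i ∧ p ≠ j) ∧ m ≤ p ∧ f p ≤ r).card +
      ((if m ≤ i ∧ f i ≤ r then 1 else 0) + (if m ≤ j ∧ f j ≤ r then 1 else 0)) := by
    intro f
    unfold tailCount
    simp only [Finset.card_filter]
    rw [← Finset.add_sum_erase _ _ (Finset.mem_univ i),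
      ← Finset.add_sum_erase _ _ (Finset.mem_erase.2 ⟨hij.ne', Finset.mem_univ j⟩),
      ← Finset.add_sum_erase (a := i) _ (fun p => if (p ≠ i ∧ p ≠ j) ∧ m ≤ p ∧ f p ≤ r then 1 else 0)
        (Finset.mem_univ i),
      ← Finset.add_sum_erase _ (fun p => if (p ≠ i ∧ p ≠ j) ∧ m ≤ p ∧ f p ≤ r then 1 else 0)
        (Finset.mem_erase.2 ⟨hij.ne', Finset.mem_univ j⟩)]
    have : ∑ x ∈ (Finset.univ.erase i).erase j, (if m ≤ x ∧ f x ≤ r then 1 else 0) =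
        ∑ x ∈ (Finset.univ.erase i).erase j,
          (if (x ≠ i ∧ x ≠ j) ∧ m ≤ x ∧ f x ≤ r then 1 else 0) := by
      refine Finset.sum_congr rfl fun x hx => ?_
      simp only [Finset.mem_erase, Finset.mem_univ, and_true] at hx
      simp [hx.1, hx.2]
    rw [this]
    simp
    omega
  rw [key, key]
  have hrest : (Finset.univ.filter fun p => (p ≠ i ∧ p ≠ j) ∧ m ≤ p ∧
      (τ * Equiv.swap i j) p ≤ r) =
      Finset.univ.filter fun p => (p ≠ i ∧ p ≠ j) ∧ m ≤ p ∧ τ p ≤ r := by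
    refine Finset.filter_congr fun p _ => and_congr_right fun hp => ?_
    simp [Equiv.swap_apply_of_ne_of_ne hp.1 hp.2]
  rw [hrest]
  simp only [Equiv.Perm.mul_apply, Equiv.swap_apply_left, Equiv.swap_apply_right]
  split_ifs <;> omega

/-- At the last position `i` where they differ, the counts force `τ i < σ i`. Swap `i` with the
nearest earlier position `j` whose value lies in `(τ i, σ i]`. Where this loses one there was slack:
at positions from `m` on, `τ` takes fewer values in `(r, σ i]` than `σ`, yet its count up to `σ i`
is at least as large. -/
lemma exists_swap_of_tailCount_le {σ τ : Equiv.Perm (Fin k)} (hne : τ ≠ σ)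
    (h : ∀ m r, tailCount σ m r ≤ tailCount τ m r) :
    ∃ i j, i < j ∧ τ j < τ i ∧
      ∀ m r, tailCount σ m r ≤ tailCount (τ * Equiv.swap i j : Equiv.Perm (Fin k)) m r := by
  classical
  obtain ⟨i, hi, hmax⟩ : ∃ i, τ i ≠ σ i ∧ ∀ p, i < p → τ p = σ p := by
    have hN : (Finset.univ.filter fun i => τ i ≠ σ i).Nonempty := by
      by_contra hcon
      refine hne (Equiv.ext fun p => ?_)
      by_contra hp
      exact hcon ⟨p, by simpa using hp⟩
    refine ⟨_, (Finset.mem_filter.1 (Finset.max'_mem _ hN)).2, fun p hp => ?_⟩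
    by_contra hp'
    exact absurd (Finset.le_max' _ p (by simpa using hp')) hp.not_ge
  have hlt : τ i < σ i := by
    refine lt_of_le_of_ne ?_ hi
    by_contra hcon
    rw [not_le] at hcon
    have hlt : tailCount τ i (σ i) < tailCount σ i (σ i) := by
      refine Finset.card_lt_card (Finset.ssubset_iff_of_subset ?_ |>.2 ⟨i, ?_, ?_⟩)
      · intro p hp
        simp only [Finset.mem_filter, Finset.mem_univ, true_and] at hp ⊢
        rcases hp.1.eq_or_lt with rfl | h1
        · exact absurd hp.2 hcon.not_ge
        · exact ⟨hp.1, hmax p h1 ▸ hp.2⟩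
      · simp
      · simpa using hcon
    exact absurd (h i (σ i)) hlt.not_ge
  obtain ⟨j, hji, hj1, hj2, hjmax⟩ : ∃ j, j < i ∧ τ i < τ j ∧ τ j ≤ σ i ∧
      ∀ p, j < p → p < i → ¬ (τ i < τ p ∧ τ p ≤ σ i) := by
    have hN : (Finset.univ.filter fun j => j < i ∧ τ i < τ j ∧ τ j ≤ σ i).Nonempty := by
      obtain ⟨p, hp⟩ := τ.surjective (σ i)
      refine ⟨p, ?_⟩
      simp only [Finset.mem_filter, Finset.mem_univ, true_and, hp, le_refl, and_true, hlt]
      rcases lt_trichotomy p i with h1 | h1 | h1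
      · exact h1
      · exact absurd (h1 ▸ hp) hi
      · exact absurd (σ.injective ((hmax p h1).symm.trans hp)) h1.ne'
    have hmem := Finset.max'_mem _ hN
    simp only [Finset.mem_filter, Finset.mem_univ, true_and] at hmem
    refine ⟨_, hmem.1, hmem.2.1, hmem.2.2, fun p hp hpi hcon => ?_⟩
    exact absurd (Finset.le_max' _ p (by simpa using ⟨hpi, hcon⟩)) hp.not_ge
  refine ⟨j, i, hji, hj1, fun m r => ?_⟩
  have hs := tailCount_swap_add τ hji hj1 m r
  have hmr := h m r
  split_ifs at hs with hc
  · obtain ⟨hjm, hmi, hir, hrj⟩ := hc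
    have hrσ : r ≤ σ i := hrj.le.trans hj2
    have h1 := tailCount_split τ m hrσ
    have h2 := tailCount_split σ m hrσ
    have h3 : (Finset.univ.filter fun p => m ≤ p ∧ r < τ p ∧ τ p ≤ σ i).card <
        (Finset.univ.filter fun p => m ≤ p ∧ r < σ p ∧ σ p ≤ σ i).card := by
      refine Finset.card_lt_card (Finset.ssubset_iff_of_subset ?_ |>.2 ⟨i, ?_, ?_⟩)
      · intro p hp
        simp only [Finset.mem_filter, Finset.mem_univ, true_and] at hp ⊢
        rcases lt_trichotomy p i with h1 | rfl | h1
        · exact absurd ⟨hir.trans_lt hp.2.1, hp.2.2⟩ (hjmax p (hjm.trans_le hp.1) h1)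
        · exact absurd hp.2.1 hir.not_gt
        · rwa [← hmax p h1]
      · simpa using ⟨hmi, hrj.trans_le hj2⟩
      · simp [hir]
    have := h m (σ i)
    omega
  · omega

lemma permCell_subset_closure_of_tailCount_le (μ : Fin n → Fin k) (σ τ : Equiv.Perm (Fin k))
    (h : ∀ m r, tailCount σ m r ≤ tailCount τ m r) :
    permCell μ τ ⊆ closure (permCell μ σ) := by
  induction hN : ∑ m, ∑ r, tailCount τ m r using Nat.strong_induction_on generalizing τ with
  | _ N ih =>
    by_cases hne : τ = σ
    · rw [hne]; exact subset_closure
    obtain ⟨i, j, hij, hτ, h'⟩ := exists_swap_of_tailCount_le hne h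
    have hle : ∀ m r, tailCount (τ * Equiv.swap i j : Equiv.Perm (Fin k)) m r ≤ tailCount τ m r :=
      fun m r => by
        have := tailCount_swap_add τ hij hτ m r
        omega
    have hlt : tailCount (τ * Equiv.swap i j : Equiv.Perm (Fin k)) j (τ j) <
        tailCount τ j (τ j) := by
      have := tailCount_swap_add τ hij hτ j (τ j)
      simp only [hij, hτ, le_refl, and_self, if_true] at this
      omega
    have hsum : ∑ m, ∑ r, tailCount (τ * Equiv.swap i j : Equiv.Perm (Fin k)) m r < N := by
      rw [← hN]
      exact Finset.sum_lt_sum (fun m _ => Finset.sum_le_sum fun r _ => hle m r)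
        ⟨j, Finset.mem_univ _, Finset.sum_lt_sum (fun r _ => hle j r) ⟨τ j, Finset.mem_univ _, hlt⟩⟩
    exact (permCell_subset_closure_of_swap μ τ hij hτ).trans
      (closure_minimal (ih _ hsum _ h' rfl) isClosed_closure)

/-! ### Leading rows -/

/-- Greedy choice: for `m` from the last position down, take the least unused `s ∈ Lead m`. For `r ≥
s` the count grows by one, the most that `σ` can gain. For `r < s` all elements of `Lead m` up to
`r` are already used, so the hypothesis at `(m, r)` gives the bound. -/
lemma exists_perm_of_tailCount_le (σ : Equiv.Perm (Fin k)) (Lead : Fin k → Finset (Fin k))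
    (h : ∀ m r, tailCount σ m r ≤ ((Lead m).filter (· ≤ r)).card) :
    ∃ τ : Equiv.Perm (Fin k), (∀ m, τ m ∈ Lead m) ∧
      ∀ m r, tailCount σ m r ≤ tailCount τ m r := by
  classical
  -- Stage `t` constrains `τ` only on the last `t` positions, those with `k ≤ p + t`.
  have step : ∀ t : ℕ, t ≤ k → ∃ τ : Fin k → Fin k,
      (∀ p q : Fin k, k ≤ p + t → k ≤ q + t → τ p = τ q → p = q) ∧
      (∀ p : Fin k, k ≤ p + t → τ p ∈ Lead p) ∧
      ∀ m r : Fin k, k ≤ m + t → tailCount σ m r ≤ tailCount τ m r := by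
    intro t
    induction t with
    | zero =>
      refine fun _ => ⟨id, ?_, ?_, ?_⟩
      · intro p _ hp; omega
      · intro p hp; omega
      · intro p _ hp; omega
    | succ t ih =>
      intro ht
      obtain ⟨τ, hinj, hlead, hcnt⟩ := ih (by omega)
      let m : Fin k := ⟨k - (t + 1), by omega⟩
      have hm : (m : ℕ) = k - (t + 1) := rfl
      have hmk : ∀ p : Fin k, k ≤ p + (t + 1) ↔ m ≤ p := fun p => by
        rw [Fin.le_def, hm]; omega
      have hmk' : ∀ p : Fin k, k ≤ p + t ↔ m < p := fun p => by
        rw [Fin.lt_def, hm]; omega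
      simp only [hmk, hmk'] at hinj hlead hcnt ⊢
      let Used : Finset (Fin k) := (Finset.univ.filter (m < ·)).image τ
      -- The threshold `k - 1` excludes no value, so `Lead m` has at least as many elements as there
      -- are positions `p ≥ m`, one more than `Used` can have.
      have hN : (Lead m \ Used).Nonempty := by
        rw [← Finset.card_pos]
        have h1 : Used.card ≤ (Finset.univ.filter fun p : Fin k => m < p).card :=
          Finset.card_image_le
        have h2 : (Finset.univ.filter fun p : Fin k => m < p).card + 1 =
            tailCount σ m ⟨k - 1, by omega⟩ := by
          have : (Finset.univ.filter fun p : Fin k => m ≤ p ∧ σ p ≤ ⟨k - 1, by omega⟩) =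
              insert m (Finset.univ.filter fun p : Fin k => m < p) := by
            ext p
            have h3 : σ p ≤ ⟨k - 1, by omega⟩ := by rw [Fin.le_def]; simp; omega
            simp only [Finset.mem_filter, Finset.mem_univ, true_and, Finset.mem_insert, h3,
              and_true]
            rw [le_iff_lt_or_eq, or_comm, @eq_comm _ m p]
          rw [tailCount, this, Finset.card_insert_of_notMem (by simp)]
        have h4 := h m ⟨k - 1, by omega⟩
        have h5 := Finset.card_filter_le (Lead m) (· ≤ (⟨k - 1, by omega⟩ : Fin k))
        have h6 := Finset.le_card_sdiff Used (Lead m)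
        omega
      let s := (Lead m \ Used).min' hN
      have hs : s ∈ Lead m ∧ s ∉ Used := Finset.mem_sdiff.1 (Finset.min'_mem _ hN)
      have hsu : ∀ p, m < p → τ p ≠ s := fun p hp hps =>
        hs.2 (Finset.mem_image.2 ⟨p, by simpa using hp, hps⟩)
      refine ⟨Function.update τ m s, ?_, ?_, ?_⟩
      · intro p q hp hq hpq
        rcases hp.eq_or_lt with rfl | hp <;> rcases hq.eq_or_lt with rfl | hq
        · rfl
        · rw [Function.update_self, Function.update_of_ne hq.ne'] at hpq
          exact absurd hpq.symm (hsu q hq)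
        · rw [Function.update_self, Function.update_of_ne hp.ne'] at hpq
          exact absurd hpq (hsu p hp)
        · rw [Function.update_of_ne hp.ne', Function.update_of_ne hq.ne'] at hpq
          exact hinj p q hp hq hpq
      · intro p hp
        rcases hp.eq_or_lt with rfl | hp
        · rw [Function.update_self]; exact hs.1
        · rw [Function.update_of_ne hp.ne']; exact hlead p hp
      · intro q r hq
        rcases hq.eq_or_lt with rfl | hq
        · rcases le_or_gt s r with hr | hr
          · have e : ∀ f : Fin k → Fin k, f m ≤ r → tailCount f m r =
                (Finset.univ.filter fun p => m < p ∧ f p ≤ r).card + 1 := by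
              intro f hf
              have : (Finset.univ.filter fun p => m ≤ p ∧ f p ≤ r) =
                  insert m (Finset.univ.filter fun p => m < p ∧ f p ≤ r) := by
                ext p
                simp only [Finset.mem_filter, Finset.mem_univ, true_and, Finset.mem_insert]
                constructor
                · rintro ⟨h1, h2⟩
                  rcases h1.eq_or_lt with h3 | h3
                  · exact Or.inl h3.symm
                  · exact Or.inr ⟨h3, h2⟩
                · rintro (rfl | ⟨h1, h2⟩)
                  · exact ⟨le_rfl, hf⟩
                  · exact ⟨h1.le, h2⟩
              rw [tailCount, this, Finset.card_insert_of_notMem (by simp)]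
            have le1 : ∀ f : Fin k → Fin k, tailCount f m r ≤
                (Finset.univ.filter fun p => m < p ∧ f p ≤ r).card + 1 := by
              intro f
              refine (Finset.card_le_card ?_).trans (Finset.card_insert_le m _)
              intro p hp
              simp only [Finset.mem_filter, Finset.mem_univ, true_and, Finset.mem_insert] at hp ⊢
              rcases hp.1.eq_or_lt with h3 | h3
              · exact Or.inl h3.symm
              · exact Or.inr ⟨h3, hp.2⟩
            rw [e (Function.update τ m s) (by rwa [Function.update_self])]
            refine (le1 σ).trans (Nat.add_le_add_right ?_ 1)
            have e2 : (Finset.univ.filter fun p => m < p ∧ Function.update τ m s p ≤ r) =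
                Finset.univ.filter fun p => m < p ∧ τ p ≤ r := by
              refine Finset.filter_congr fun p _ => and_congr_right fun hp => ?_
              rw [Function.update_of_ne hp.ne']
            rw [e2]
            by_cases hlast : (m : ℕ) + 1 < k
            · have := hcnt ⟨m + 1, hlast⟩ r (by rw [Fin.lt_def]; simp)
              have e3 : ∀ p : Fin k, (⟨m + 1, hlast⟩ : Fin k) ≤ p ↔ m < p := fun p => by
                rw [Fin.le_def, Fin.lt_def]; simp
              simpa only [tailCount, e3] using this
            · rw [Finset.card_eq_zero.2]
              · exact Nat.zero_le _
              · refine Finset.filter_eq_empty_iff.2 fun p _ hp => ?_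
                have := Fin.lt_def.1 hp.1
                omega
          · refine (h m r).trans ?_
            have hsub : (Lead m).filter (· ≤ r) ⊆
                (Finset.univ.filter fun p => m ≤ p ∧ Function.update τ m s p ≤ r).image
                  (Function.update τ m s) := by
              intro x hx
              rw [Finset.mem_filter] at hx
              have hxU : x ∈ Used := by
                by_contra hcon
                exact absurd ((Finset.min'_le _ x (Finset.mem_sdiff.2 ⟨hx.1, hcon⟩)).trans hx.2)
                  hr.not_ge
              obtain ⟨p, hp, rfl⟩ := Finset.mem_image.1 hxU
              have hp : m < p := by simpa using hp
              refine Finset.mem_image.2 ⟨p, ?_, Function.update_of_ne hp.ne' _ _⟩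
              rw [Finset.mem_filter, Function.update_of_ne hp.ne']
              exact ⟨Finset.mem_univ _, hp.le, hx.2⟩
            exact (Finset.card_le_card hsub).trans Finset.card_image_le
        · refine (hcnt q r hq).trans (le_of_eq ?_)
          unfold tailCount
          congr 1
          refine Finset.filter_congr fun p _ => and_congr_right fun hp => ?_
          rw [Function.update_of_ne (hq.trans_le hp).ne']
  obtain ⟨τ, hinj, hlead, hcnt⟩ := step k le_rfl
  have hinj' : Function.Injective τ := fun p q => hinj p q (by omega) (by omega)
  exact ⟨Equiv.ofBijective τ (Finite.injective_iff_bijective.1 hinj'),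
    fun m => hlead m (by omega), fun m r => hcnt m r (by omega)⟩

/-- The row `s` is leading for the columns `j` with `μ j < m` of `A` if the row `s` of this
submatrix is in the span of the rows above it. -/
def IsLeading (μ : Fin n → Fin k) (A : Matrix (Fin k) (Fin n) ℂ) (m s : Fin k) : Prop :=
  ∃ φ : Fin k → ℂ, φ s = 1 ∧ (∀ s', s < s' → φ s' = 0) ∧ ∀ j, μ j < m → φ ⬝ᵥ A.col j = 0

/-- Place the functional for `m` in row `τ m` of a matrix `G`. Then `G` is lower unitriangular, `G *
A` has the required zeros, and `b` is the inverse of `G`. -/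
lemma mem_permCell_of_isLeading {μ : Fin n → Fin k} {A : Matrix (Fin k) (Fin n) ℂ}
    {τ : Equiv.Perm (Fin k)} (h : ∀ m, IsLeading μ A m (τ m)) : A ∈ permCell μ τ := by
  choose φ h1 h2 h3 using h
  let G : Matrix (Fin k) (Fin k) ℂ := Matrix.of fun s => φ (τ.symm s)
  have hG : G ∈ lowerUnitriangular k := by
    refine ⟨fun i => ?_, fun i j hij => h2 _ _ (by simpa using hij)⟩
    change φ (τ.symm i) i = 1
    simpa using h1 (τ.symm i)
  obtain ⟨b, hb, hbG⟩ := exists_left_inverse_mem_lowerUnitriangular hG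
  refine ⟨b, hb, (G * A).submatrix τ id, fun p j hp => ?_, ?_⟩
  · have := h3 p j hp
    simpa [G, Matrix.mul_apply, dotProduct] using this
  · have : ((G * A).submatrix τ id).submatrix τ.symm id = G * A := by
      ext; simp
    rw [this, ← Matrix.mul_assoc, hbG, Matrix.one_mul]

lemma mem_closure_openPermCell {μ : Fin n → Fin k} {A : Matrix (Fin k) (Fin n) ℂ}
    {σ : Equiv.Perm (Fin k)} (Lead : Fin k → Finset (Fin k))
    (hL : ∀ m, ∀ s ∈ Lead m, IsLeading μ A m s)
    (h : ∀ m r, tailCount σ m r ≤ ((Lead m).filter (· ≤ r)).card) :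
    A ∈ closure (openPermCell μ σ) := by
  obtain ⟨τ, h1, h2⟩ := exists_perm_of_tailCount_le σ Lead h
  have hA : A ∈ permCell μ τ := mem_permCell_of_isLeading fun m => hL m _ (h1 m)
  exact closure_minimal (permCell_subset_closure_openPermCell μ σ) isClosed_closure
    (permCell_subset_closure_of_tailCount_le μ σ τ h2 hA)

/-! ### Flag minors -/

lemma sum_castLE {R : ℕ} (hR : R ≤ k) (g : Fin k → ℂ) (hg : ∀ s : Fin k, R ≤ s → g s = 0) :
    ∑ s, g s = ∑ s : Fin R, g (Fin.castLE hR s) := by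
  refine Eq.trans ?_ (Finset.sum_map Finset.univ (Fin.castLEEmb hR) g)
  refine (Finset.sum_subset (Finset.subset_univ _) fun s _ hs => hg s ?_).symm
  by_contra hcon
  exact hs (Finset.mem_map.2 ⟨⟨s, by omega⟩, Finset.mem_univ _, by ext; simp⟩)

lemma flagMinor_lowerUnitriangular_mul (J : FlagIndex n k) {X : Matrix (Fin k) (Fin k) ℂ}
    (hX : X ∈ lowerUnitriangular k) (Y : Matrix (Fin k) (Fin n) ℂ) :
    flagMinor J (X * Y) = flagMinor J Y := by
  have h1 : (X * Y).submatrix (Fin.castLE J.2.2) (J.1.orderEmbOfFin rfl) =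
      X.submatrix (Fin.castLE J.2.2) (Fin.castLE J.2.2) *
        Y.submatrix (Fin.castLE J.2.2) (J.1.orderEmbOfFin rfl) := by
    ext a c
    simp only [Matrix.submatrix_apply, Matrix.mul_apply]
    refine sum_castLE J.2.2 _ fun s hs => ?_
    rw [hX.2 _ _ (by rw [Fin.lt_def, Fin.val_castLE]; omega), zero_mul]
  have h2 : X.submatrix (Fin.castLE J.2.2) (Fin.castLE J.2.2) ∈ lowerUnitriangular J.1.card :=
    ⟨fun i => hX.1 _, fun i j hij => hX.2 _ _ hij⟩
  rw [flagMinor, h1, Matrix.det_mul, det_of_mem_lowerUnitriangular h2, one_mul, flagMinor]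

/-- The number of positions `p < m` with value `τ p ≤ r`. -/
def headCount (τ : Fin k → Fin k) (m r : Fin k) : ℕ :=
  (Finset.univ.filter fun p => p < m ∧ τ p ≤ r).card

lemma headCount_add_tailCount (τ : Equiv.Perm (Fin k)) (m r : Fin k) :
    headCount τ m r + tailCount τ m r = r + 1 := by
  rw [headCount, tailCount, ← Finset.card_union_of_disjoint]
  · have : (Finset.univ.filter fun p => p < m ∧ τ p ≤ r) ∪
        (Finset.univ.filter fun p => m ≤ p ∧ τ p ≤ r) = (Finset.Iic r).map τ.symm.toEmbedding := by
      ext p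
      simp only [Finset.mem_union, Finset.mem_filter, Finset.mem_univ, true_and, Finset.mem_map,
        Finset.mem_Iic, Equiv.coe_toEmbedding]
      constructor
      · rintro (⟨_, h⟩ | ⟨_, h⟩) <;> exact ⟨τ p, h, by simp⟩
      · rintro ⟨s, hs, rfl⟩
        rcases lt_or_ge (τ.symm s) m with h | h
        · exact Or.inl ⟨h, by simpa using hs⟩
        · exact Or.inr ⟨h, by simpa using hs⟩
    rw [this, Finset.card_map, Fin.card_Iic]
  · rw [Finset.disjoint_filter]
    rintro p - ⟨h, _⟩ ⟨h', _⟩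
    exact absurd h' h.not_ge

/-- A nonzero term of the determinant would inject the columns of `J` with `μ j < m` into the rows
`s ≤ r` with `σ⁻¹ s < m`, of which there are too few. -/
lemma flagMinor_eq_zero_of_headCount_lt {μ : Fin n → Fin k} {σ : Equiv.Perm (Fin k)}
    {Y : Matrix (Fin k) (Fin n) ℂ} (hY : ∀ s j, μ j < σ.symm s → Y s j = 0)
    (J : FlagIndex n k) {m r : Fin k} (hr : J.1.card = r + 1)
    (h : headCount σ m r < (J.1.filter (μ · < m)).card) : flagMinor J Y = 0 := by
  classical
  rw [flagMinor, Matrix.det_apply]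
  refine Finset.sum_eq_zero fun π _ => ?_
  by_contra hcon
  have hne : ∀ i, Y (Fin.castLE J.2.2 (π i)) (J.1.orderEmbOfFin rfl i) ≠ 0 := fun i hi => by
    refine hcon ?_
    rw [Finset.prod_eq_zero (Finset.mem_univ i), smul_zero]
    exact hi
  let I := Finset.univ.filter fun i => μ (J.1.orderEmbOfFin rfl i) < m
  have h1 : (J.1.filter (μ · < m)).card ≤ I.card := by
    refine (Finset.card_le_card ?_).trans
      (Finset.card_image_le (s := I) (f := J.1.orderEmbOfFin rfl))
    intro j hj
    rw [Finset.mem_filter] at hj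
    have : j ∈ Set.range (J.1.orderEmbOfFin rfl) := by
      rw [Finset.range_orderEmbOfFin]; exact hj.1
    obtain ⟨i, rfl⟩ := this
    exact Finset.mem_image.2 ⟨i, by simpa [I] using hj.2, rfl⟩
  have h2 : I.card ≤ headCount σ m r := by
    refine Finset.card_le_card_of_injOn (fun i => σ.symm (Fin.castLE J.2.2 (π i))) ?_ ?_
    · intro i hi
      have hi : μ (J.1.orderEmbOfFin rfl i) < m := by simpa [I] using hi
      simp only [Finset.coe_filter, Finset.mem_univ, true_and, Set.mem_ofPred_eq,
        Equiv.apply_symm_apply]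
      refine ⟨lt_of_le_of_lt ?_ hi, ?_⟩
      · by_contra hlt
        exact hne i (hY _ _ (not_le.1 hlt))
      · rw [Fin.le_def, Fin.val_castLE]
        omega
    · intro a _ c _ hac
      exact π.injective (Fin.castLE_injective _ (σ.symm.injective hac))
  omega

lemma exists_basis_columns {R : ℕ} (B : Matrix (Fin R) (Fin n) ℂ) (hB : B.rank = R)
    (C : Set (Fin n)) :
    ∃ J : Finset (Fin n), J.card = R ∧ LinearIndepOn ℂ B.col (J : Set (Fin n)) ∧
      ∀ j ∈ C, B.col j ∈ Submodule.span ℂ (B.col '' (J ∩ C)) := by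
  classical
  obtain ⟨b, hbC, -, hb, hbi⟩ :=
    exists_linearIndepOn_extension (linearIndepOn_empty ℂ B.col) (Set.empty_subset C)
  obtain ⟨b', -, hbb', hb', hbi'⟩ := exists_linearIndepOn_extension hbi (Set.subset_univ b)
  refine ⟨b'.toFinset, ?_, by simpa using hbi', fun j hj => ?_⟩
  · have h1 : Submodule.span ℂ (B.col '' b') = ⊤ := by
      have h2 : Submodule.span ℂ (Set.range B.col) = ⊤ := by
        rw [Matrix.rank_eq_finrank_span_cols] at hB
        exact Submodule.eq_top_of_finrank_eq (by simpa using hB)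
      rw [eq_top_iff, ← h2, Submodule.span_le, ← Set.image_univ]
      exact hb'
    have h3 := finrank_span_eq_card hbi'
    rw [← Set.image_eq_range, h1] at h3
    simpa using h3.symm
  · refine Submodule.span_mono (Set.image_mono ?_) (hb ⟨j, hj, rfl⟩)
    intro x hx
    exact ⟨by simpa using hbb' hx, hbC hx⟩

lemma rank_submatrix_castLE {A : Matrix (Fin k) (Fin n) ℂ} (hA : A.rank = k) {R : ℕ}
    (hR : R ≤ k) : (A.submatrix (Fin.castLE hR) id).rank = R := by
  have h1 : LinearIndependent ℂ A.row := by
    rw [linearIndependent_iff_card_eq_finrank_span, Set.finrank, ← Matrix.rank_eq_finrank_span_row,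
      hA, Fintype.card_fin]
  have h2 : LinearIndependent ℂ (A.submatrix (Fin.castLE hR) id).row :=
    h1.comp _ (Fin.castLE_injective hR)
  simpa using h2.rank_matrix

lemma flagMinor_ne_zero {A : Matrix (Fin k) (Fin n) ℂ} (J : FlagIndex n k)
    (h : LinearIndepOn ℂ (A.submatrix (Fin.castLE J.2.2) id).col (J.1 : Set (Fin n))) :
    flagMinor J A ≠ 0 := by
  have h1 : LinearIndependent ℂ
      (A.submatrix (Fin.castLE J.2.2) (J.1.orderEmbOfFin rfl)).col := by
    have h2 := LinearIndependent.comp h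
      (fun i => (⟨J.1.orderEmbOfFin rfl i, Finset.orderEmbOfFin_mem _ _ _⟩ : (J.1 : Set (Fin n))))
      (fun a c hac => (J.1.orderEmbOfFin rfl).injective (congrArg Subtype.val hac))
    exact h2
  rw [Matrix.linearIndependent_cols_iff_isUnit, Matrix.isUnit_iff_isUnit_det] at h1
  exact h1.ne_zero

/-- A row relation killing the columns `J₀` kills all columns with `μ j < m`, so its last nonzero
entry sits in a leading row. Hence a vector is zero once it kills `J₀` and vanishes at the leading
rows: `Ψ` is injective, and dimensions compare. -/
lemma card_le_card_isLeading {μ : Fin n → Fin k} {A : Matrix (Fin k) (Fin n) ℂ} (m r : Fin k)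
    (J₀ : Finset (Fin n))
    (hJ : ∀ j, μ j < m → (A.submatrix (Fin.castLE r.2) id).col j ∈
      Submodule.span ℂ ((A.submatrix (Fin.castLE r.2) id).col '' J₀)) (Lead : Finset (Fin k))
    (hL : ∀ s, s ≤ r → IsLeading μ A m s → s ∈ Lead) :
    r + 1 ≤ J₀.card + (Lead.filter (· ≤ r)).card := by
  classical
  let B := A.submatrix (Fin.castLE r.2) id
  let Ψ : (Fin (r + 1) → ℂ) →ₗ[ℂ] (J₀ → ℂ) × (Lead.filter (· ≤ r) → ℂ) :=
    { toFun := fun φ => (fun j => φ ⬝ᵥ B.col j, fun s => φ ⟨s.1,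
        Nat.lt_succ_of_le (Fin.le_def.1 (Finset.mem_filter.1 s.2).2)⟩)
      map_add' := fun φ ψ => by ext <;> simp [add_dotProduct]
      map_smul' := fun c φ => by ext <;> simp [smul_dotProduct] }
  have hΨ : Function.Injective Ψ := by
    rw [injective_iff_map_eq_zero]
    intro φ hφ
    by_contra hne
    have hφ1 : ∀ j ∈ J₀, φ ⬝ᵥ B.col j = 0 := fun j hj => congrFun (congrArg Prod.fst hφ) ⟨j, hj⟩
    have hφ2 : ∀ s : Fin k, ∀ hs : s ∈ Lead.filter (· ≤ r), φ ⟨s.1,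
        Nat.lt_succ_of_le (Fin.le_def.1 (Finset.mem_filter.1 hs).2)⟩ = 0 :=
      fun s hs => congrFun (congrArg Prod.snd hφ) ⟨s, hs⟩
    have hN : (Finset.univ.filter fun s => φ s ≠ 0).Nonempty := by
      by_contra hcon
      refine hne (funext fun s => ?_)
      by_contra hs
      exact hcon ⟨s, by simpa using hs⟩
    obtain ⟨s, hs, hmax⟩ : ∃ s, φ s ≠ 0 ∧ ∀ s', s < s' → φ s' = 0 := by
      refine ⟨_, (Finset.mem_filter.1 (Finset.max'_mem _ hN)).2, fun s' hs' => ?_⟩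
      by_contra hcon
      exact absurd (Finset.le_max' _ s' (by simpa using hcon)) hs'.not_ge
    have hsr : Fin.castLE r.2 s ≤ r := Fin.le_def.2 (Nat.le_of_lt_succ s.2)
    refine hs (hφ2 (Fin.castLE r.2 s) (Finset.mem_filter.2 ⟨hL _ hsr ?_, hsr⟩))
    refine ⟨fun s' => if h : (s' : ℕ) < r + 1 then (φ s)⁻¹ * φ ⟨s', h⟩ else 0, ?_, ?_, ?_⟩
    · simpa [hs] using Fin.le_def.1 hsr
    · intro s' hs'
      dsimp only
      split_ifs with h
      · rw [hmax ⟨s', h⟩ hs', mul_zero]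
      · rfl
    · intro j hj
      have h0 : φ ⬝ᵥ B.col j = 0 := by
        refine Submodule.span_induction (p := fun x _ => φ ⬝ᵥ x = 0) ?_ (dotProduct_zero φ)
          (fun x y _ _ hx hy => by rw [dotProduct_add, hx, hy, add_zero])
          (fun c x _ hx => by rw [dotProduct_smul, hx, smul_zero]) (hJ j hj)
        rintro _ ⟨i, hi, rfl⟩
        exact hφ1 i hi
      rw [dotProduct, sum_castLE (R := r + 1) r.2]
      · simp only [Fin.val_castLE, Fin.is_lt, dite_true, Fin.eta, mul_assoc]
        rw [← Finset.mul_sum]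
        exact mul_eq_zero_of_right _ h0
      · intro s' hs'
        simp [hs'.not_gt]
  have := LinearMap.finrank_le_finrank_of_injective hΨ
  rwa [Module.finrank_prod, Module.finrank_fintype_fun_eq_card,
    Module.finrank_fintype_fun_eq_card, Module.finrank_fintype_fun_eq_card, Fintype.card_fin,
    Fintype.card_coe, Fintype.card_coe] at this

/-- Extend a basis of the truncated columns with `μ j < m` to a basis of all truncated columns. Its
minor is nonzero, so the hypothesis bounds the size of the first basis by `headCount`; the
complementary bound on leading rows is `tailCount`. -/
lemma mem_closure_openPermCell_of_flagMinor {μ : Fin n → Fin k} {σ : Equiv.Perm (Fin k)}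
    {A : Matrix (Fin k) (Fin n) ℂ} (hA : A.rank = k)
    (h : ∀ (J : FlagIndex n k) (m r : Fin k), J.1.card = r + 1 →
      headCount σ m r < (J.1.filter (μ · < m)).card → flagMinor J A = 0) :
    A ∈ closure (openPermCell μ σ) := by
  classical
  refine mem_closure_openPermCell (fun m => Finset.univ.filter (IsLeading μ A m))
    (fun m s hs => (Finset.mem_filter.1 hs).2) fun m r => ?_
  obtain ⟨J, hJ1, hJ2, hJ3⟩ := exists_basis_columns (A.submatrix (Fin.castLE r.2) id)
    (rank_submatrix_castLE hA r.2) {j | μ j < m}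
  have h1 := card_le_card_isLeading (A := A) m r (J.filter (μ · < m)) (fun j hj => by
    rw [Finset.coe_filter]
    exact hJ3 j hj)
    (Finset.univ.filter (IsLeading μ A m)) (fun s _ hs => by simpa using hs)
  have h2 : (J.filter (μ · < m)).card ≤ headCount σ m r := by
    by_contra hlt
    have hJk : J.card ≤ k := by rw [hJ1]; exact r.2
    refine flagMinor_ne_zero (A := A) ⟨J, by omega, hJk⟩ ?_ (h ⟨J, by omega, hJk⟩ m r hJ1 (not_le.1 hlt))
    have : ∀ R (hR : R ≤ k), J.card = R →
        LinearIndepOn ℂ (A.submatrix (Fin.castLE hR) id).col (J : Set (Fin n)) →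
        LinearIndepOn ℂ (A.submatrix (Fin.castLE hJk) id).col (J : Set (Fin n)) := by
      rintro R hR rfl h
      exact h
    exact this _ _ hJ1 hJ2
  have h3 := headCount_add_tailCount σ m r
  omega

/-! ### The cell of a Fubini word -/

lemma apply_alpha (w : FubiniWord n k) (a : Fin k) : w (alpha w a) = a := by
  have := Finset.min'_mem _ (w.fiber_nonempty a)
  exact (Finset.mem_filter.1 this).2

lemma alpha_injective (w : FubiniWord n k) : Function.Injective (alpha w) := fun a b h => by
  rw [← apply_alpha w a, h, apply_alpha]

lemma isStar_iff (w : FubiniWord n k) (r : Fin k) (j : Fin n) :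
    IsStar w r j ↔ alpha w r < alpha w (w j) ∧ (j ∈ initialPositions w → r < w j) := by
  constructor
  · rintro ⟨_, rfl, ⟨a, rfl⟩, h1, h2⟩
    rw [apply_alpha] at h2 ⊢
    exact ⟨h1, fun hj => h2.elim (fun h => h.2) fun h => absurd hj h⟩
  · rintro ⟨h1, h2⟩
    refine ⟨alpha w r, apply_alpha w r, ⟨r, rfl⟩, h1, ?_⟩
    rw [apply_alpha]
    by_cases hj : j ∈ initialPositions w
    · exact Or.inl ⟨hj, h2 hj⟩
    · exact Or.inr hj

lemma exists_letterOrder (w : FubiniWord n k) :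
    ∃ σ : Equiv.Perm (Fin k), ∀ a b, alpha w a < alpha w b ↔ σ.symm a < σ.symm b := by
  have h : StrictMono (alpha w ∘ Tuple.sort (alpha w)) :=
    (Tuple.monotone_sort (alpha w)).strictMono_of_injective
      ((alpha_injective w).comp (Equiv.injective _))
  refine ⟨Tuple.sort (alpha w), fun a b => ?_⟩
  rw [← h.lt_iff_lt]
  simp

lemma patternSet_apply_eq_zero {w : FubiniWord n k} {σ : Equiv.Perm (Fin k)}
    (hσ : ∀ a b, alpha w a < alpha w b ↔ σ.symm a < σ.symm b)
    {Y : Matrix (Fin k) (Fin n) ℂ} (hY : Y ∈ patternSet w) (s : Fin k) (j : Fin n)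
    (h : σ.symm (w j) < σ.symm s) : Y s j = 0 := by
  refine (hY s j).2 ?_ ?_
  · rintro rfl
    exact lt_irrefl _ h
  · rw [isStar_iff]
    rintro ⟨h1, -⟩
    exact absurd h1 ((hσ _ _).2 h).not_gt

/-- A principal submatrix of a triangular matrix with nonzero diagonal is again of this kind, hence
invertible. -/
lemma exists_solution_of_upperTriangular (R : Matrix (Fin k) (Fin k) ℂ)
    (hR : ∀ p l, l < p → R p l = 0) (hd : ∀ p, R p p ≠ 0) (P : Finset (Fin k)) (v : Fin k → ℂ) :
    ∃ x : Fin k → ℂ, (∀ p, p ∉ P → x p = 0) ∧ ∀ l ∈ P, ∑ p, x p * R p l = v l := by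
  let S : Matrix P P ℂ := R.submatrix Subtype.val Subtype.val
  have hdet : IsUnit S.det := by
    rw [Matrix.det_of_isUpperTriangular fun p l hpl => hR p.1 l.1 hpl, isUnit_iff_ne_zero]
    exact Finset.prod_ne_zero_iff.2 fun p _ => hd p
  let y : P → ℂ := Matrix.vecMul (fun l : P => v l) S⁻¹
  have hy : Matrix.vecMul y S = fun l : P => v l := by
    rw [Matrix.vecMul_vecMul, Matrix.nonsing_inv_mul S hdet, Matrix.vecMul_one]
  refine ⟨fun p => if h : p ∈ P then y ⟨p, h⟩ else 0, fun p hp => by simp [hp], fun l hl => ?_⟩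
  have := congrFun hy ⟨l, hl⟩
  rw [Matrix.vecMul, dotProduct] at this
  rw [← this, ← Finset.sum_subset (Finset.subset_univ P) (fun p _ hp => by simp [hp]),
    ← Finset.sum_coe_sort P]
  refine Finset.sum_congr rfl fun p _ => ?_
  simp [S]

/-- Beyond the shape of `Q`, the pattern requires a zero in row `σ m` at the first occurrence of `σ
l` whenever `m < l` and `σ l < σ m`. Adding multiples of the rows `σ p`, for `p` in the same range
as `l`, clears these entries. The operation is lower unitriangular, and its coefficients solve a
triangular system because the initial columns of `Q` are triangular. Rescaling columns then makes
the entries `(w j, j)` equal to `1`. -/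
lemma exists_cellMatrices_of_mem_openPermCell {w : FubiniWord n k} {σ : Equiv.Perm (Fin k)}
    (hσ : ∀ a b, alpha w a < alpha w b ↔ σ.symm a < σ.symm b) {A : Matrix (Fin k) (Fin n) ℂ}
    (hA : A ∈ openPermCell (fun j => σ.symm (w j)) σ) :
    ∃ M ∈ cellMatrices w, ∃ d : Fin n → ℂ, ∀ r j, A r j = d j * M r j := by
  obtain ⟨b, hb, Q, hQ, hQd, rfl⟩ := hA
  have hQ : ∀ p j, σ.symm (w j) < p → Q p j = 0 := hQ
  choose x hx1 hx2 using fun m : Fin k => exists_solution_of_upperTriangular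
    (Matrix.of fun p l => Q p (alpha w (σ l)))
    (fun p l h => hQ _ _ (by rwa [apply_alpha, Equiv.symm_apply_apply]))
    (fun p => by simpa only [Matrix.of_apply, apply_alpha, Equiv.symm_apply_apply] using hQd (alpha w (σ p)))
    (Finset.univ.filter fun p => m < p ∧ σ p < σ m) (fun l => - Q m (alpha w (σ l)))
  simp only [Finset.mem_filter, Finset.mem_univ, true_and, Matrix.of_apply] at hx1 hx2
  let G : Matrix (Fin k) (Fin k) ℂ := Matrix.of fun r s =>
    (if s = r then 1 else 0) + x (σ.symm r) (σ.symm s)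
  have hG : G ∈ lowerUnitriangular k := by
    refine ⟨fun i => ?_, fun i j hij => ?_⟩
    · simp [G, hx1]
    · simp [G, hij.ne', hx1, hij.le]
  have hGN : ∀ m j, (G * Q.submatrix σ.symm id) (σ m) j = Q m j + ∑ p, x m p * Q p j := by
    intro m j
    rw [Matrix.mul_apply, ← Equiv.sum_comp σ]
    simp [G, add_mul, Finset.sum_add_distrib]
  obtain ⟨G', hG', hGG⟩ := exists_left_inverse_mem_lowerUnitriangular hG
  -- Only rows with `p > m` are added, so the zeros of `Q` and its entries `(μ j, j)` survive.
  have hsum : ∀ m j, σ.symm (w j) ≤ m → ∑ p, x m p * Q p j = 0 := by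
    refine fun m j hj => Finset.sum_eq_zero fun p _ => ?_
    by_cases hp : m < p
    · rw [hQ p j (hj.trans_lt hp), mul_zero]
    · rw [hx1 m p (fun h => hp h.1), zero_mul]
  refine ⟨b * G' * Matrix.of fun r j => (Q (σ.symm (w j)) j)⁻¹ * (G * Q.submatrix σ.symm id) r j,
    ⟨b * G', mul_mem_lowerUnitriangular hb hG', _, fun r j => ?_, rfl⟩,
    fun j => Q (σ.symm (w j)) j, fun r j => ?_⟩
  · obtain ⟨m, rfl⟩ := σ.surjective r
    rw [Matrix.of_apply, hGN]
    refine ⟨fun h => ?_, fun h hs => ?_⟩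
    · have hm : m = σ.symm (w j) := by rw [← h, Equiv.symm_apply_apply]
      rw [hsum m j hm.ge, hm, add_zero, inv_mul_cancel₀ (hQd j)]
    · refine mul_eq_zero_of_right _ ?_
      rcases lt_trichotomy m (σ.symm (w j)) with hm | rfl | hm
      · rw [isStar_iff, hσ, Equiv.symm_apply_apply] at hs
        push Not at hs
        obtain ⟨⟨a, rfl⟩, h2⟩ := hs hm
        rw [apply_alpha] at hm h2 h
        have := hx2 m (σ.symm a) ⟨hm, by simpa using lt_of_le_of_ne h2 h.symm⟩
        rw [Equiv.apply_symm_apply] at this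
        rw [this, add_neg_cancel]
      · simp at h
      · rw [hQ m j hm, hsum m j hm.le, add_zero]
  · have h1 : b * Q.submatrix σ.symm id = b * G' * (G * Q.submatrix σ.symm id) := by
      rw [Matrix.mul_assoc b, ← Matrix.mul_assoc G', hGG, Matrix.one_mul]
    rw [h1, Matrix.mul_apply, Matrix.mul_apply, Finset.mul_sum]
    refine Finset.sum_congr rfl fun s _ => ?_
    rw [Matrix.of_apply]
    have := hQd j
    field_simp

lemma cellMatrices_fullRank {w : FubiniWord n k} {M : Matrix (Fin k) (Fin n) ℂ}
    (hM : M ∈ cellMatrices w) : M.rank = k ∧ ∀ j, M.col j ≠ 0 := by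
  obtain ⟨X, hX, Y, hY, rfl⟩ := hM
  obtain ⟨σ, hσ⟩ := exists_letterOrder w
  constructor
  · refine le_antisymm ((Matrix.rank_le_card_height _).trans (by simp)) ?_
    -- With rows and columns ordered by first appearance, the initial columns of `Y` form an upper
    -- unitriangular matrix.
    have h1 : (Y.submatrix id (alpha w)).det = 1 := by
      rw [← Matrix.det_submatrix_equiv_self σ, Matrix.det_of_isUpperTriangular]
      · refine Finset.prod_eq_one fun i _ => (hY _ _).1 ?_
        simp [apply_alpha]
      · intro p l hpl
        exact patternSet_apply_eq_zero hσ hY _ _ (by simpa [apply_alpha] using hpl)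
    have h2 : (X * Y) * (1 : Matrix (Fin n) (Fin n) ℂ).submatrix id (alpha w) =
        X * Y.submatrix id (alpha w) := by
      rw [Matrix.mul_assoc]
      congr 1
      ext a c
      simp [Matrix.mul_apply, Matrix.one_apply]
    have h3 : (X * Y.submatrix id (alpha w)).rank = k := by
      rw [Matrix.rank_of_isUnit, Fintype.card_fin]
      rw [Matrix.isUnit_iff_isUnit_det, Matrix.det_mul, h1, det_of_mem_lowerUnitriangular hX]
      simp
    rw [← h2] at h3
    exact h3.ge.trans (Matrix.rank_mul_le_left _ _)
  · intro j hj
    have h1 : X.mulVec (Y.col j) = 0 := hj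
    have h2 := Matrix.eq_zero_of_mulVec_eq_zero
      (by rw [det_of_mem_lowerUnitriangular hX]; exact one_ne_zero) h1
    have h3 := (hY (w j) j).1 rfl
    have h4 := congrFun h2 (w j)
    simp [h3] at h4

/-! ### Multihomogeneous polynomials -/

/-- The value of the polynomial `f` at the matrix `A`. -/
def evalMatrix (f : MvPolynomial (Fin k × Fin n) ℂ) (A : Matrix (Fin k) (Fin n) ℂ) : ℂ :=
  MvPolynomial.eval (fun p : Fin k × Fin n => A p.1 p.2) f

lemma continuous_evalMatrix (f : MvPolynomial (Fin k × Fin n) ℂ) :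
    Continuous (evalMatrix f) := by
  unfold evalMatrix
  exact (MvPolynomial.continuous_eval f).comp
    (continuous_pi fun p => continuous_id.matrix_elem p.1 p.2)

lemma IsMultihomogeneous.exists_evalMatrix_scale {f : MvPolynomial (Fin k × Fin n) ℂ}
    (hf : IsMultihomogeneous f) : ∃ d : Fin n → ℕ, ∀ (A B : Matrix (Fin k) (Fin n) ℂ)
      (c : Fin n → ℂ), (∀ r j, A r j = c j * B r j) →
        evalMatrix f A = (∏ j, c j ^ d j) * evalMatrix f B := by
  obtain ⟨d, hd⟩ := hf
  refine ⟨d, fun A B c h => ?_⟩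
  rw [evalMatrix, evalMatrix, MvPolynomial.eval_eq', MvPolynomial.eval_eq', Finset.mul_sum]
  refine Finset.sum_congr rfl fun e he => ?_
  have he := hd (MvPolynomial.mem_support_iff.1 he)
  have h1 : ∀ j, ∑ r, e (r, j) = d j := fun j => by
    rw [← he, Finsupp.weight_apply, Finsupp.sum_fintype _ _ (by simp),
      Finset.sum_apply, Fintype.sum_prod_type]
    simp [Pi.single_apply]
  simp only [h, mul_pow, Finset.prod_mul_distrib]
  have h2 : ∏ p : Fin k × Fin n, c p.2 ^ e p = ∏ j, c j ^ d j := by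
    rw [Fintype.prod_prod_type_right]
    refine Finset.prod_congr rfl fun j _ => ?_
    rw [← h1 j]
    exact Finset.prod_pow_eq_pow_sum Finset.univ (fun r => e (r, j)) (c j)
  rw [h2]
  ring

lemma IsMultihomogeneous.evalMatrix_eq_zero_iff {f : MvPolynomial (Fin k × Fin n) ℂ}
    (hf : IsMultihomogeneous f) {A B : Matrix (Fin k) (Fin n) ℂ} {c : Fin n → ℂ}
    (hc : ∀ j, c j ≠ 0) (h : ∀ r j, A r j = c j * B r j) :
    evalMatrix f A = 0 ↔ evalMatrix f B = 0 := by
  obtain ⟨d, hd⟩ := hf.exists_evalMatrix_scale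
  rw [hd A B c h, mul_eq_zero, or_iff_right]
  exact Finset.prod_ne_zero_iff.2 fun j _ => pow_ne_zero _ (hc j)

lemma evalRep_toConfig_eq_zero_iff {f : MvPolynomial (Fin k × Fin n) ℂ}
    (hf : IsMultihomogeneous f) (A : FullRankMatrix n k) :
    evalRep f (toConfig A).1 = 0 ↔ evalMatrix f A.1 = 0 := by
  choose c hc using fun j => Projectivization.exists_smul_eq_mk_rep ℂ (A.1.col j) (A.2.2 j)
  refine hf.evalMatrix_eq_zero_iff (A := Matrix.of fun r j => ((toConfig A).1 j).rep r)
    (c := fun j => c j) (fun j => (c j).ne_zero) fun r j => ?_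
  exact (congrFun (hc j) r).symm

/-- The flag minor as a polynomial in the matrix entries. -/
def flagMinorPolynomial (J : FlagIndex n k) : MvPolynomial (Fin k × Fin n) ℂ :=
  Matrix.det (Matrix.of fun i l =>
    MvPolynomial.X (Fin.castLE J.2.2 i, J.1.orderEmbOfFin rfl l))

lemma evalMatrix_flagMinorPolynomial (J : FlagIndex n k) (A : Matrix (Fin k) (Fin n) ℂ) :
    evalMatrix (flagMinorPolynomial J) A = flagMinor J A := by
  rw [evalMatrix, flagMinorPolynomial, RingHom.map_det, flagMinor]
  congr 1
  ext i l
  simp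

lemma isMultihomogeneous_flagMinorPolynomial (J : FlagIndex n k) :
    IsMultihomogeneous (flagMinorPolynomial J) := by
  refine ⟨∑ l, Pi.single (J.1.orderEmbOfFin rfl l) 1, ?_⟩
  rw [flagMinorPolynomial, Matrix.det_apply]
  refine MvPolynomial.IsWeightedHomogeneous.sum _ _ _ fun π _ => ?_
  rw [Units.smul_def, zsmul_eq_mul, ← zero_add (∑ l, _)]
  refine MvPolynomial.IsWeightedHomogeneous.mul ?_ ?_
  · have := MvPolynomial.isWeightedHomogeneous_C (R := ℂ)
      (fun p : Fin k × Fin n => (Pi.single p.2 1 : Fin n → ℕ)) ((Equiv.Perm.sign π : ℤ) : ℂ)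
    simpa using this
  · exact MvPolynomial.IsWeightedHomogeneous.prod _ _ _ fun l _ =>
      MvPolynomial.isWeightedHomogeneous_X ℂ _ _

/-! ### The Zariski closure of the cell -/

/-- Closed sets are cut out by multihomogeneous polynomials, whose vanishing does not depend on
representatives, so the closure can be tested on matrices. -/
lemma mem_prVariety_iff (w : FubiniWord n k) (A : FullRankMatrix n k) :
    toConfig A ∈ prVariety w ↔ ∀ f : MvPolynomial (Fin k × Fin n) ℂ, IsMultihomogeneous f →
      (∀ M ∈ cellMatrices w, evalMatrix f M = 0) → evalMatrix f A.1 = 0 := by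
  let _ := zariskiTopology n k
  have hclosed : ∀ Z : Set (LineTuple n k), IsClosed Z ↔ IsZariskiClosed Z := fun Z => by
    rw [← isOpen_compl_iff]
    change Zᶜᶜ ∈ {Z | IsZariskiClosed Z} ↔ _
    rw [compl_compl]
    rfl
  constructor
  · intro hA f hf h
    rw [← evalRep_toConfig_eq_zero_iff hf]
    have hZ : IsClosed {l : SpanningLineConfig n k | evalRep f l.1 = 0} := by
      refine isClosed_induced_iff.2 ⟨zeroLocus {f}, (hclosed _).2 ⟨{f}, by simpa using hf, rfl⟩, ?_⟩
      ext l
      simp only [zeroLocus, Set.mem_singleton_iff, forall_eq]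
      rfl
    refine closure_minimal ?_ hZ hA
    rintro _ ⟨M, hM, rfl⟩
    exact (evalRep_toConfig_eq_zero_iff hf M).2 (h _ hM)
  · intro h
    rintro Z ⟨hZ, hsub⟩
    obtain ⟨Z', hZ', rfl⟩ := isClosed_induced_iff.1 hZ
    obtain ⟨S, hS, rfl⟩ := (hclosed _).1 hZ'
    intro f hf
    refine (evalRep_toConfig_eq_zero_iff (hS f hf) A).2 (h f (hS f hf) fun M hM => ?_)
    let M' : FullRankMatrix n k := ⟨M, cellMatrices_fullRank hM⟩
    have hM' : toConfig M' ∈ prCell w := Set.mem_image_of_mem toConfig hM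
    have hmem : (toConfig M').1 ∈ zeroLocus S := hsub hM'
    exact (evalRep_toConfig_eq_zero_iff (hS f hf) M').1 (hmem f hf)

lemma toConfig_surjective : Function.Surjective (toConfig : FullRankMatrix n k → _) := by
  rintro ⟨l, hl⟩
  have hspan : Submodule.span ℂ (Set.range fun j => (l j).rep) = ⊤ := by
    rw [Submodule.span_range_eq_iSup, ← hl]
    simp only [Projectivization.submodule_eq]
  refine ⟨⟨Matrix.of fun r j => (l j).rep r, ?_, fun j => (l j).rep_nonzero⟩, ?_⟩
  · rw [Matrix.rank_eq_finrank_span_cols]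
    have : (Matrix.of fun r j => (l j).rep r).col = fun j => (l j).rep := rfl
    rw [this, hspan]
    simp
  · refine Subtype.ext (funext fun j => ?_)
    exact (l j).mk_rep

lemma toConfig_mem_prVariety_iff (w : FubiniWord n k) (A : FullRankMatrix n k) :
    toConfig A ∈ prVariety w ↔ ∀ J ∈ trulyVanishing w, flagMinor J A.1 = 0 := by
  rw [mem_prVariety_iff]
  constructor
  · intro h J hJ
    rw [← evalMatrix_flagMinorPolynomial]
    exact h _ (isMultihomogeneous_flagMinorPolynomial J) fun M hM => by
      rw [evalMatrix_flagMinorPolynomial]; exact hJ M hM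
  · intro h f hf hfM
    obtain ⟨σ, hσ⟩ := exists_letterOrder w
    have hA : A.1 ∈ closure (openPermCell (fun j => σ.symm (w j)) σ) := by
      -- The minors killed by counting belong to `trulyVanishing w`: they vanish on the pattern, and
      -- the factor in `U` does not change flag minors.
      refine mem_closure_openPermCell_of_flagMinor A.2.1 fun J m r hJ hlt => h J ?_
      rintro _ ⟨X, hX, Y, hY, rfl⟩
      rw [flagMinor_lowerUnitriangular_mul J hX]
      exact flagMinor_eq_zero_of_headCount_lt (patternSet_apply_eq_zero hσ hY) J hJ hlt
    have hZ : IsClosed {B : Matrix (Fin k) (Fin n) ℂ | evalMatrix f B = 0} :=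
      isClosed_singleton.preimage (continuous_evalMatrix f)
    refine closure_minimal ?_ hZ hA
    intro B hB
    obtain ⟨M, hM, c, hc⟩ := exists_cellMatrices_of_mem_openPermCell hσ hB
    obtain ⟨d, hd⟩ := hf.exists_evalMatrix_scale
    change evalMatrix f B = 0
    rw [hd B M c hc, hfM M hM, mul_zero]

end FubiniFlag

end

/-- The second conjunct says that the condition does not depend on the representing matrix. -/
theorem mainTheorem1 (n k : ℕ) (hk : 0 < k) (w : FubiniFlag.FubiniWord n k) :
    FubiniFlag.prVariety w =
        FubiniFlag.toConfig ''
          {A : FubiniFlag.FullRankMatrix n k |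
            ∀ J ∈ FubiniFlag.trulyVanishing w, FubiniFlag.flagMinor J A.1 = 0} ∧
      ∀ A : FubiniFlag.FullRankMatrix n k,
        FubiniFlag.toConfig A ∈ FubiniFlag.prVariety w ↔
          ∀ J ∈ FubiniFlag.trulyVanishing w, FubiniFlag.flagMinor J A.1 = 0 := by
  refine ⟨Set.ext fun l => ⟨fun hl => ?_, ?_⟩, FubiniFlag.toConfig_mem_prVariety_iff w⟩
  · obtain ⟨A, rfl⟩ := FubiniFlag.toConfig_surjective l
    exact ⟨A, (FubiniFlag.toConfig_mem_prVariety_iff w A).1 hl, rfl⟩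
  · rintro ⟨A, hA, rfl⟩
    exact (FubiniFlag.toConfig_mem_prVariety_iff w A).2 hA
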